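/- Let $\alpha\in\mathbb R$, $r\ge 0$ and $k\in\mathbb R$, and let $h(t)=(t+r)^k e^{-\alpha t}$ for $t>0$. Let $C_0^\infty(\mathbb R_+)$ be the complex vector space of smooth complex-valued functions with compact support in $\mathbb R_+=(0,\infty)$. For $f\in C_0^\infty(\mathbb R_+)$ put $$(\bar f\star f)(t)=\int_0^t\overline{f(s)}\,f(t-s)\,ds,\qquad h[f,f]=\int_0^\infty h(t)\,\overline{(\bar f\star f)(t)}\,dt .$$ Let $N_\pm(h)\in\{0,1,2,\dots\}\cup\{\infty\}$ be the maximal dimension of a complex linear subspace $\mathcal M\subset C_0^\infty(\mathbb R_+)$ such that $\pm h[f,f]>0$ for all $f\in\mathcal M$, $f\ne0$ (the maximum being attained, also when it is $\infty$). Then the quadratic form $h[f,f]$ is real, and the following holds. 1. If $k<0$, then $h[f,f]\ge 0$ for all $f\in C_0^\infty(\mathbb R_+)$. 2. If $k>0$ and $k$ is not an integer, let $[k]$ be the integer part of $k$. If $[k]$ is even, then $N_+(h)=[k]/2+1$ and $N_-(h)=\infty$. If $[k]$ is odd, then $N_-(h)=([k]+1)/2$ and $N_+(h)=\infty$. -/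

import Mathlib

open MeasureTheory
open scoped ComplexConjugate

/-- The open half-line of strictly positive reals. -/
def posHalfLine : TopologicalSpace.Opens ℝ := ⟨Set.Ioi 0, isOpen_Ioi⟩

/-- Smooth complex-valued functions whose support is a compact subset of the open half-line.
The last argument of `TestFunction` has type `ℕ∞`, so `⊤` means infinitely differentiable. -/
abbrev HalfLineTest : Type := TestFunction posHalfLine ℂ ⊤

/-- The Laplace convolution of the conjugate of `f₁` with `f₂`. -/
noncomputable def laplaceConv (f₁ f₂ : ℝ → ℂ) (t : ℝ) : ℂ :=
  ∫ s in (0 : ℝ)..t, conj (f₁ s) * f₂ (t - s)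

/-- The sesquilinear pairing of a kernel `h` with a function `F` on the half-line, linear in `h`
and antilinear in `F`. -/
noncomputable def kernelPairing (h : ℝ → ℝ) (F : ℝ → ℂ) : ℂ :=
  ∫ t in Set.Ioi (0 : ℝ), (h t : ℂ) * conj (F t)

/-- The Hankel form of the kernel `h` evaluated at a test function `f`: the pairing of `h` with the
Laplace convolution of the conjugate of `f` with `f`. -/
noncomputable def hankelForm (h : ℝ → ℝ) (f : HalfLineTest) : ℂ :=
  kernelPairing h (laplaceConv f f)

/-- The Hankel form as a real-valued quadratic form (for a real kernel the form is real). -/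
noncomputable def hankelQuad (h : ℝ → ℝ) (f : HalfLineTest) : ℝ :=
  (hankelForm h f).re

/-- `N` is the maximal dimension (`⊤` standing for infinite dimension) of a complex linear subspace
of `V` on whose nonzero elements `q` is strictly positive; the maximum is attained. -/
def IsPosIndex {V : Type*} [AddCommGroup V] [Module ℂ V] (q : V → ℝ) (N : ℕ∞) : Prop :=
  IsGreatest {d : ℕ∞ | ∃ M : Submodule ℂ V, (∀ φ ∈ M, φ ≠ 0 → 0 < q φ) ∧
    Cardinal.toENat (Module.rank ℂ M) = d} N

/-- The same with `q` strictly negative on the nonzero elements of the subspace. -/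
def IsNegIndex {V : Type*} [AddCommGroup V] [Module ℂ V] (q : V → ℝ) (N : ℕ∞) : Prop :=
  IsPosIndex (fun φ => -q φ) N

/-- The quasi-Carleman kernel; only its values at `t > 0` matter. -/
noncomputable def quasiCarleman (α r k : ℝ) (t : ℝ) : ℝ :=
  (t + r) ^ k * Real.exp (-α * t)

/-! A test function vanishes to the left of some `d > 0`. With x(s) = (s - d)/(s + d + r), which
lies in [0, 1) for s ≥ d, the kernel factors as h(s + u) = w(s) w(u) (1 - x(s) x(u))^k
(`quasiCarleman_add_eq`). Expanding the last factor in the binomial series, with c_j the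
coefficients of (1 - z)^k, diagonalizes the form: h[f,f] = ∑ c_j |m_j(f)|², where m_j(f) = ∫ x^j w f
(`hasSum_hankelForm`). The moments depend on `d`, but the signs of the c_j do not.

For k < 0 all c_j are positive. For non-integer k > 0, (-1)^[k] c_j is positive exactly when j ≤ [k]
has the parity of [k] (`sign_signedBinomial`), which gives [k]/2 + 1 indices. A positive subspace of
(-1)^[k] h cannot be larger, since otherwise a nonzero element would have all these moments zero.
Conversely, the sequences √|c_j| m_j(f) are dense in ℓ² (`dense_range_scaledMoments`), so the
signature of the diagonal form is attained on test functions. -/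

/-! ### Dense subspaces of inner product spaces. -/

section HilbertSpace

variable {H : Type} [NormedAddCommGroup H] [InnerProductSpace ℂ H]

/-- If `y` is close to a vector `x` of the span of an orthonormal family, then most of the norm of
`y` is carried by its components along the family. -/
theorem Orthonormal.norm_sq_lt_two_mul_sum {ι : Type} [Fintype ι] {e : ι → H}
    (he : Orthonormal ℂ e) (z : ι → ℂ) (y : H) (hx : ∑ i, z i • e i ≠ 0)
    (hy : ‖y - ∑ i, z i • e i‖ ≤ ‖∑ i, z i • e i‖ / 8) :
    ‖y‖ ^ 2 < 2 * ∑ i, ‖inner ℂ (e i) y‖ ^ 2 := by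
  set x := ∑ i, z i • e i with hxdef
  have hxpos : 0 < ‖x‖ := norm_pos_iff.mpr hx
  have hz : ∀ i, inner ℂ (e i) x = z i := fun i => he.inner_right_fintype z i
  have hxx : ‖x‖ ^ 2 = ∑ i, ‖z i‖ ^ 2 := by
    have h1 : inner ℂ x x = ∑ i, conj (z i) * z i := he.inner_sum z z Finset.univ
    rw [inner_self_eq_norm_sq_to_K] at h1
    have h2 : ((‖x‖ ^ 2 : ℝ) : ℂ) = ((∑ i, ‖z i‖ ^ 2 : ℝ) : ℂ) := by
      push_cast
      simpa [Complex.conj_mul'] using h1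
    exact_mod_cast h2
  have hxy : ‖inner ℂ x y‖ ^ 2 ≤ ‖x‖ ^ 2 * ∑ i, ‖inner ℂ (e i) y‖ ^ 2 := by
    have h1 : inner ℂ x y = ∑ i, conj (z i) * inner ℂ (e i) y := by
      rw [hxdef, sum_inner]
      simp [inner_smul_left]
    have h2 : ‖inner ℂ x y‖ ≤ ∑ i, ‖z i‖ * ‖inner ℂ (e i) y‖ := by
      rw [h1]
      refine (norm_sum_le _ _).trans (le_of_eq ?_)
      simp
    rw [hxx]
    exact (pow_le_pow_left₀ (norm_nonneg _) h2 2).trans (Finset.sum_mul_sq_le_sq_mul_sq _ _ _)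
  -- The bounds 7/8 below and 9/8 above suffice because (9/8)² = 81/64 is less than 2 · (7/8)² =
  -- 98/64.
  have hlow : 7 / 8 * ‖x‖ ^ 2 ≤ ‖inner ℂ x y‖ := by
    have h1 : inner ℂ x x = inner ℂ x y - inner ℂ x (y - x) := by rw [← inner_sub_right]; simp
    have h2 : ‖x‖ ^ 2 ≤ ‖inner ℂ x y‖ + ‖inner ℂ x (y - x)‖ := by
      have : ‖inner ℂ x x‖ = ‖x‖ ^ 2 := by simp [inner_self_eq_norm_sq_to_K]
      rw [← this, h1]
      exact norm_sub_le _ _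
    have h3 : ‖inner ℂ x (y - x)‖ ≤ ‖x‖ * (‖x‖ / 8) :=
      (norm_inner_le_norm _ _).trans (by gcongr)
    nlinarith
  have hnorm : ‖y‖ ≤ 9 / 8 * ‖x‖ := by
    have : ‖y‖ ≤ ‖y - x‖ + ‖x‖ := by simpa using norm_add_le (y - x) x
    linarith
  have hS : 49 / 64 * ‖x‖ ^ 2 ≤ ∑ i, ‖inner ℂ (e i) y‖ ^ 2 := by
    have h1 : (7 / 8 * ‖x‖ ^ 2) ^ 2 ≤ ‖x‖ ^ 2 * ∑ i, ‖inner ℂ (e i) y‖ ^ 2 :=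
      (pow_le_pow_left₀ (by positivity) hlow 2).trans hxy
    have h2 : 0 < ‖x‖ ^ 2 := by positivity
    refine le_of_mul_le_mul_left ?_ h2
    linarith
  have : ‖y‖ ^ 2 ≤ (9 / 8 * ‖x‖) ^ 2 := pow_le_pow_left₀ (norm_nonneg _) hnorm 2
  nlinarith [pow_pos hxpos 2]

/-- A dense subspace contains a subspace of the dimension of a given finite orthonormal family on
which the components along that family dominate. -/
theorem Dense.exists_submodule_norm_sq_lt {ι : Type} [Fintype ι] {R : Submodule ℂ H}
    (hR : Dense (R : Set H)) {e : ι → H} (he : Orthonormal ℂ e) :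
    ∃ W ≤ R, Module.rank ℂ W = Fintype.card ι ∧
      ∀ w ∈ W, w ≠ 0 → ‖w‖ ^ 2 < 2 * ∑ i, ‖inner ℂ (e i) w‖ ^ 2 := by
  -- The errors of all basis vectors together stay below ‖x‖/8; the `+ 1` covers the empty family.
  set ε : ℝ := 1 / (8 * (Fintype.card ι + 1)) with hε
  have hεpos : 0 < ε := by positivity
  have hv : ∀ i, ∃ v ∈ R, ‖v - e i‖ < ε := fun i => by
    obtain ⟨v, hv, hd⟩ := hR.exists_dist_lt (e i) hεpos
    exact ⟨v, hv, by rwa [← dist_eq_norm, dist_comm]⟩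
  choose v hvR hve using hv
  have key : ∀ z : ι → ℂ, z ≠ 0 →
      ‖∑ i, z i • v i‖ ^ 2 < 2 * ∑ i, ‖inner ℂ (e i) (∑ j, z j • v j)‖ ^ 2 := by
    intro z hz
    have hx : ∑ i, z i • e i ≠ 0 := fun h0 =>
      hz (funext fun i => Fintype.linearIndependent_iff.mp he.linearIndependent z h0 i)
    refine he.norm_sq_lt_two_mul_sum z _ hx ?_
    have h1 : ∀ i, ‖z i‖ ≤ ‖∑ i, z i • e i‖ := fun i => by
      rw [← he.inner_right_fintype z i]
      simpa [he.1 i] using norm_inner_le_norm (𝕜 := ℂ) (e i) (∑ i, z i • e i)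
    rw [← Finset.sum_sub_distrib]
    calc ‖∑ i, (z i • v i - z i • e i)‖ ≤ ∑ i, ‖z i • v i - z i • e i‖ := norm_sum_le _ _
      _ ≤ ∑ _i : ι, ‖∑ i, z i • e i‖ * ε := by
          refine Finset.sum_le_sum fun i _ => ?_
          rw [← smul_sub, norm_smul]
          exact mul_le_mul (h1 i) (hve i).le (norm_nonneg _) (norm_nonneg _)
      _ = ‖∑ i, z i • e i‖ * (Fintype.card ι * ε) := by simp; ring
      _ ≤ ‖∑ i, z i • e i‖ * (1 / 8) := by
          gcongr
          rw [hε, mul_one_div, div_le_div_iff₀ (by positivity) (by norm_num)]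
          linarith
      _ = _ := by ring
  have hli : LinearIndependent ℂ v := by
    rw [Fintype.linearIndependent_iff]
    intro z hz
    by_contra! hne
    have := key z (fun h => by obtain ⟨i, hi⟩ := hne; exact hi (congrFun h i))
    simp [hz] at this
  refine ⟨Submodule.span ℂ (Set.range v), Submodule.span_le.mpr ?_, ?_, ?_⟩
  · rintro _ ⟨i, rfl⟩
    exact hvR i
  · rw [rank_span hli, Cardinal.mk_range_eq v hli.injective, Cardinal.mk_fintype]
  · intro w hw hw0
    obtain ⟨z, rfl⟩ := (Submodule.mem_span_range_iff_exists_fun ℂ).mp hw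
    exact key z (fun h => hw0 (by simp [h]))

/-- A dense subspace of an infinite-dimensional space meets the orthogonal complement of a finite
family in an infinite-dimensional subspace. -/
theorem Dense.exists_submodule_orthogonal {ι : Type} [Fintype ι] {R : Submodule ℂ H}
    (hR : Dense (R : Set H)) (hH : ¬ FiniteDimensional ℂ H) (e : ι → H) :
    ∃ W ≤ R, Cardinal.aleph0 ≤ Module.rank ℂ W ∧ ∀ w ∈ W, ∀ i, inner ℂ (e i) w = 0 := by
  let A : H →ₗ[ℂ] (ι → ℂ) := LinearMap.pi fun i => (innerSL ℂ (e i)).toLinearMap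
  refine ⟨R ⊓ LinearMap.ker A, inf_le_left, ?_, ?_⟩
  · by_contra! hlt
    have hfin : FiniteDimensional ℂ (R ⊓ LinearMap.ker A : Submodule ℂ H) :=
      Module.rank_lt_aleph0_iff.mp hlt
    -- Rank-nullity for `A` restricted to `R`: kernel and range are both finite-dimensional. Then
    -- `R` is closed as well as dense, hence everything.
    have hRfin : FiniteDimensional ℂ R := by
      have hk : FiniteDimensional ℂ (LinearMap.ker (A.domRestrict R)) := by
        let g : LinearMap.ker (A.domRestrict R) →ₗ[ℂ] (R ⊓ LinearMap.ker A : Submodule ℂ H) :=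
          { toFun := fun x => ⟨x.1.1, x.1.2, x.2⟩
            map_add' := fun _ _ => rfl
            map_smul' := fun _ _ => rfl }
        refine Module.Finite.of_injective g fun x y hxy => ?_
        have := congrArg Subtype.val hxy
        exact Subtype.ext (Subtype.ext this)
      have := LinearMap.rank_range_add_rank_ker (A.domRestrict R)
      refine Module.rank_lt_aleph0_iff.mp ?_
      rw [← this]
      exact Cardinal.add_lt_aleph0 (Module.rank_lt_aleph0 ℂ _) (Module.rank_lt_aleph0 ℂ _)
    have hclosed : IsClosed (R : Set H) := R.closed_of_finiteDimensional
    have htop : R = ⊤ := SetLike.coe_injective (by simpa [hclosed.closure_eq] using hR.closure_eq)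
    exact hH (Module.Finite.equiv ((LinearEquiv.ofEq _ _ htop).trans Submodule.topEquiv))
  · rintro w ⟨-, hw⟩ i
    exact congrFun (LinearMap.mem_ker.mp hw) i

end HilbertSpace

/-- A subspace of the range of a linear map lifts to a subspace of the source. -/
theorem LinearMap.exists_submodule_lift {V H : Type} [AddCommGroup V] [Module ℂ V]
    [AddCommGroup H] [Module ℂ H] (T : V →ₗ[ℂ] H) {W : Submodule ℂ H}
    (hW : W ≤ LinearMap.range T) :
    ∃ M : Submodule ℂ V, Module.rank ℂ M = Module.rank ℂ W ∧
      ∀ f ∈ M, T f ∈ W ∧ (f ≠ 0 → T f ≠ 0) := by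
  obtain ⟨g, hg⟩ := T.rangeRestrict.exists_rightInverse_of_surjective T.range_rangeRestrict
  have hgT : ∀ x, T (g x) = x := fun x => congrArg Subtype.val (LinearMap.congr_fun hg x)
  let σ : W →ₗ[ℂ] V := g ∘ₗ Submodule.inclusion hW
  have hσ : ∀ w : W, T (σ w) = w := fun w => hgT _
  have hinj : Function.Injective σ := fun x y hxy =>
    Subtype.ext (by rw [← hσ x, ← hσ y, hxy])
  refine ⟨LinearMap.range σ, (LinearEquiv.ofInjective σ hinj).rank_eq.symm, ?_⟩
  rintro _ ⟨w, rfl⟩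
  rw [hσ]
  exact ⟨w.2, fun h h0 => h (by rw [show w = 0 from Subtype.ext h0, map_zero])⟩

/-! ### Signs of the binomial coefficients. -/

/-- The Taylor coefficients of `(1 - z) ^ k` at `z = 0`. -/
noncomputable def signedBinomial (k : ℝ) (j : ℕ) : ℝ := (-1) ^ j * Ring.choose k j

theorem signedBinomial_zero (k : ℝ) : signedBinomial k 0 = 1 := by simp [signedBinomial]

theorem signedBinomial_succ (k : ℝ) (j : ℕ) :
    signedBinomial k (j + 1) = signedBinomial k j * ((j - k) / (j + 1)) := by
  simp only [signedBinomial, Ring.choose_eq_smul, descPochhammer_succ_right,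
    Polynomial.smeval_mul, Polynomial.smeval_sub, Polynomial.smeval_X, Polynomial.smeval_natCast,
    Nat.factorial_succ, smul_eq_mul, pow_succ]
  have : ((j.factorial : ℕ) : ℝ) ≠ 0 := by positivity
  have : (j : ℝ) + 1 ≠ 0 := by positivity
  push_cast
  field_simp
  simp
  ring

theorem hasSum_signedBinomial (k : ℝ) {z : ℝ} (hz : |z| < 1) :
    HasSum (fun j => signedBinomial k j * z ^ j) ((1 - z) ^ k) := by
  have h := (Real.one_add_rpow_hasFPowerSeriesOnBall_zero (a := k)).hasSum (y := -z)
    (by simpa [enorm_eq_nnnorm, ← NNReal.coe_lt_coe] using hz)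
  simp only [binomialSeries_apply, List.ofFn_const, List.prod_replicate, smul_eq_mul, zero_add] at h
  rw [sub_eq_add_neg]
  refine h.congr_fun fun j => ?_
  rw [signedBinomial, neg_pow z]
  ring

theorem summable_abs_signedBinomial (k : ℝ) {q : ℝ} (h0 : 0 ≤ q) (h1 : q < 1) :
    Summable fun j => |signedBinomial k j| * q ^ j := by
  have := (hasSum_signedBinomial k (z := q) (by rwa [abs_of_nonneg h0])).summable.abs
  simpa [abs_mul, abs_of_nonneg h0] using this

theorem signedBinomial_pos_of_neg {k : ℝ} (hk : k < 0) (j : ℕ) : 0 < signedBinomial k j := by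
  induction j with
  | zero => simp [signedBinomial_zero]
  | succ j ih =>
    rw [signedBinomial_succ]
    have : (0 : ℝ) < j - k := by linarith [(Nat.cast_nonneg j : (0 : ℝ) ≤ j)]
    positivity

/-- The coefficient is a product of factors (i - k)/(i + 1) with i ≤ j - 1 < k, all negative. -/
theorem neg_one_pow_mul_signedBinomial_pos {k : ℝ} {j : ℕ} (hj : (j : ℝ) < k + 1) :
    0 < (-1) ^ j * signedBinomial k j := by
  induction j with
  | zero => simp [signedBinomial_zero]
  | succ j ih =>
    push_cast at hj
    have hjk : 0 < k - j := by linarith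
    have := ih (by linarith)
    have h2 : (-1) ^ (j + 1) * signedBinomial k (j + 1)
        = (-1) ^ j * signedBinomial k j * ((k - j) / (j + 1)) := by
      rw [signedBinomial_succ]; ring
    rw [h2]
    positivity

/-- The factor with i = ⌊k⌋ is the last one that can be negative, so from index ⌊k⌋ + 1 on the sign
no longer changes. -/
theorem neg_one_pow_floor_mul_signedBinomial_neg {k : ℝ} (hk : 0 < k) {j : ℕ} (hj : ⌊k⌋₊ < j) :
    (-1) ^ ⌊k⌋₊ * signedBinomial k j ≤ 0 := by
  induction j, hj using Nat.le_induction with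
  | base =>
    have h := neg_one_pow_mul_signedBinomial_pos (k := k) (j := ⌊k⌋₊) (by
      linarith [Nat.floor_le hk.le])
    have h2 : (⌊k⌋₊ - k) / (⌊k⌋₊ + 1) ≤ 0 :=
      div_nonpos_of_nonpos_of_nonneg (by linarith [Nat.floor_le hk.le]) (by positivity)
    rw [signedBinomial_succ, ← mul_assoc]
    exact mul_nonpos_of_nonneg_of_nonpos h.le h2
  | succ j hj ih =>
    have h2 : 0 ≤ ((j : ℝ) - k) / (j + 1) := by
      have : k < ⌊k⌋₊ + 1 := Nat.lt_floor_add_one k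
      have : ((⌊k⌋₊ + 1 : ℕ) : ℝ) ≤ j := by exact_mod_cast hj
      push_cast at this
      exact div_nonneg (by linarith) (by positivity)
    rw [signedBinomial_succ, ← mul_assoc]
    exact mul_nonpos_of_nonpos_of_nonneg ih h2

/-- For natural `k` the series terminates; this is where non-integrality enters, and density of the
moments rests on it. -/
theorem signedBinomial_ne_zero {k : ℝ} (hk : ∀ n : ℕ, k ≠ n) (j : ℕ) : signedBinomial k j ≠ 0 := by
  induction j with
  | zero => simp [signedBinomial_zero]
  | succ j ih =>
    rw [signedBinomial_succ]
    exact mul_ne_zero ih (div_ne_zero (sub_ne_zero.mpr (hk j).symm) (by positivity))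

/-- The indices `j ≤ n` of the same parity as `n`. -/
def sameParityIndices (n : ℕ) : Finset ℕ := (Finset.range (n + 1)).filter fun j => Even (n + j)

theorem card_sameParityIndices (n : ℕ) : (sameParityIndices n).card = n / 2 + 1 := by
  have : sameParityIndices n = (Finset.range (n / 2 + 1)).image fun i => n - 2 * i := by
    ext j
    simp only [sameParityIndices, Finset.mem_filter, Finset.mem_range, Finset.mem_image]
    constructor
    · rintro ⟨h1, m, hm⟩
      exact ⟨(n - j) / 2, by omega, by omega⟩
    · rintro ⟨i, hi, rfl⟩
      exact ⟨by omega, n - i, by omega⟩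
  rw [this, Finset.card_image_of_injOn, Finset.card_range]
  intro a ha b hb hab
  simp only [Finset.coe_range, Set.mem_Iio] at ha hb hab
  omega

theorem sign_signedBinomial {k : ℝ} (hk : 0 < k) (j : ℕ) :
    (-1) ^ ⌊k⌋₊ * signedBinomial k j =
      (if j ∈ sameParityIndices ⌊k⌋₊ then 1 else -1) * |signedBinomial k j| := by
  have habs : |(-1) ^ ⌊k⌋₊ * signedBinomial k j| = |signedBinomial k j| := by
    simp [abs_mul]
  rw [← habs]
  rcases lt_or_ge ⌊k⌋₊ j with hj | hj
  · have : j ∉ sameParityIndices ⌊k⌋₊ := by simp [sameParityIndices]; omega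
    rw [if_neg this, abs_of_nonpos (neg_one_pow_floor_mul_signedBinomial_neg hk hj)]
    ring
  · have hjk : (j : ℝ) < k + 1 := by
      have : (j : ℝ) ≤ ⌊k⌋₊ := by exact_mod_cast hj
      linarith [Nat.floor_le hk.le]
    have h := neg_one_pow_mul_signedBinomial_pos hjk
    rcases Nat.even_or_odd (⌊k⌋₊ + j) with hp | hp
    · have hmem : j ∈ sameParityIndices ⌊k⌋₊ := by simp [sameParityIndices, hp]; omega
      have he : (-1 : ℝ) ^ ⌊k⌋₊ = (-1) ^ j := by
        rcases Nat.even_add.mp hp with hh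
        rcases Nat.even_or_odd j with h2 | h2
        · rw [(hh.mpr h2).neg_one_pow, h2.neg_one_pow]
        · rw [h2.neg_one_pow, Odd.neg_one_pow]
          exact Nat.not_even_iff_odd.mp fun h3 => (Nat.not_even_iff_odd.mpr h2) (hh.mp h3)
      rw [if_pos hmem, he, abs_of_pos h]
      ring
    · have hmem : j ∉ sameParityIndices ⌊k⌋₊ := by
        simp [sameParityIndices, hp]
      have he : (-1 : ℝ) ^ ⌊k⌋₊ = -(-1) ^ j := by
        have h3 := hp.neg_one_pow (α := ℝ)
        rw [pow_add] at h3
        rcases neg_one_pow_eq_or ℝ j with h2 | h2 <;> rw [h2] at h3 ⊢ <;> linarith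
      rw [if_neg hmem, he, abs_of_nonpos (by linarith)]
      ring

/-- A power series that vanishes on the real interval `(0, 1)` has zero coefficients. -/
theorem eq_zero_of_tsum_mul_pow_eq_zero {b : ℕ → ℂ}
    (hb : ∀ q : ℝ, 0 ≤ q → q < 1 → Summable fun j => ‖b j‖ * q ^ j)
    (h0 : ∀ w : ℝ, 0 < w → w < 1 → ∑' j, b j * (w : ℂ) ^ j = 0) : b = 0 := by
  set p := FormalMultilinearSeries.ofScalars ℂ b with hp
  have hrad : (1 / 2 : NNReal) ≤ p.radius := by
    refine p.le_radius_of_summable ?_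
    refine (hb (1 / 2) (by norm_num) (by norm_num)).of_nonneg_of_le (fun _ => by positivity)
      fun j => ?_
    rw [hp, FormalMultilinearSeries.ofScalars_norm]
    simp
  have hpos : 0 < p.radius := lt_of_lt_of_le (by norm_num) hrad
  have hP := (p.hasFPowerSeriesOnBall hpos).hasFPowerSeriesAt
  have hsum : ∀ w : ℝ, 0 < w → w < 1 → p.sum (w : ℂ) = 0 := fun w hw hw1 => by
    rw [← h0 w hw hw1, hp]
    simp [FormalMultilinearSeries.sum, mul_comm]
  -- Positive reals tending to 0 are zeros accumulating at the centre, so the identity principle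
  -- applies.
  have hfreq : ∃ᶠ z in nhdsWithin (0 : ℂ) {0}ᶜ, p.sum z = 0 := by
    have ht : Filter.Tendsto (fun w : ℝ => (w : ℂ)) (nhdsWithin 0 (Set.Ioi 0))
        (nhdsWithin (0 : ℂ) {0}ᶜ) := by
      refine tendsto_nhdsWithin_iff.mpr ⟨?_, ?_⟩
      · exact (Complex.continuous_ofReal.tendsto' 0 0 (by simp)).mono_left nhdsWithin_le_nhds
      · filter_upwards [self_mem_nhdsWithin] with w hw
        simpa using (ne_of_gt hw)
    refine ht.frequently (Filter.Eventually.frequently ?_)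
    filter_upwards [Ioo_mem_nhdsGT (zero_lt_one (α := ℝ))] with w hw
    exact hsum w hw.1 hw.2
  have hev := (hP.analyticAt.frequently_zero_iff_eventually_zero).mp hfreq
  have hz : p = 0 := (hP.congr hev).eq_zero
  funext j
  have hj : p j (fun _ => 1) = 0 := by rw [hz]; rfl
  simpa [hp] using hj

/-! ### Test functions and the form as a double integral. -/

theorem HalfLineTest.apply_eq_zero (f : HalfLineTest) {s : ℝ} (hs : s ≤ 0) : f s = 0 := by
  by_contra h
  have : s ∈ (posHalfLine : Set ℝ) := f.tsupport_subset (subset_tsupport _ h)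
  exact absurd this (not_lt.mpr hs)

theorem HalfLineTest.integrable_mul (f : HalfLineTest) {g : ℝ → ℂ} (hg : Continuous g) :
    Integrable (fun s => g s * f s) :=
  (hg.mul f.continuous).integrable_of_hasCompactSupport f.hasCompactSupport.mul_left

/-- The Hankel form as a double integral. -/
theorem hankelForm_eq_integral_prod (h : ℝ → ℝ) (f : HalfLineTest)
    (hint : Integrable (fun p : ℝ × ℝ => (h (p.1 + p.2) : ℂ) * (f p.1 * conj (f p.2)))) :
    hankelForm h f = ∫ p : ℝ × ℝ, (h (p.1 + p.2) : ℂ) * (f p.1 * conj (f p.2)) := by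
  -- The substitution (t, s) ↦ (s, t - s) undoes the convolution.
  have hmp : MeasurePreserving (fun z : ℝ × ℝ => (z.2, -z.2 + z.1)) :=
    measurePreserving_prod_neg_add_swap volume volume
  have hemb : MeasurableEmbedding (fun z : ℝ × ℝ => (z.2, -z.2 + z.1)) := by
    refine (Homeomorph.toMeasurableEquiv
      { toFun := fun z : ℝ × ℝ => (z.2, -z.2 + z.1)
        invFun := fun z => (z.1 + z.2, z.1)
        left_inv := fun z => by simp
        right_inv := fun z => by simp
        continuous_toFun := by fun_prop
        continuous_invFun := by fun_prop }).measurableEmbedding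
  rw [← hmp.integral_comp hemb, hankelForm, kernelPairing, ← integral_indicator measurableSet_Ioi,
    Measure.volume_eq_prod, integral_prod]
  · refine integral_congr_ae (Filter.Eventually.of_forall fun t => ?_)
    simp only
    rcases lt_or_ge 0 t with ht | ht
    · rw [Set.indicator_of_mem (Set.mem_Ioi.mpr ht), laplaceConv,
        intervalIntegral.integral_of_le ht.le, ← integral_conj, ← integral_const_mul,
        -- Outside (0, t] one of the two factors has a nonpositive argument and vanishes.
        setIntegral_eq_integral_of_forall_compl_eq_zero]
      · refine integral_congr_ae (Filter.Eventually.of_forall fun s => ?_)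
        simp only [map_mul, Complex.conj_conj]
        rw [add_neg_cancel_left, neg_add_eq_sub]
      · intro s hs
        rcases le_or_gt s 0 with h0 | h0
        · simp [f.apply_eq_zero h0]
        · have : t < s := by
            by_contra! hst
            exact hs ⟨h0, hst⟩
          simp [f.apply_eq_zero (show t - s ≤ 0 by linarith)]
    · rw [Set.indicator_of_notMem (by simpa using ht), eq_comm]
      refine integral_eq_zero_of_ae (Filter.Eventually.of_forall fun s => ?_)
      rcases le_or_gt s 0 with h0 | h0
      · simp [f.apply_eq_zero h0]
      · simp [f.apply_eq_zero (show -s + t ≤ 0 by linarith)]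
  · exact (hmp.integrable_comp_emb hemb).mpr hint

/-- The test functions vanishing to the left of `d`. -/
def testAbove (d : ℝ) : Submodule ℂ HalfLineTest where
  carrier := {f | ∀ s < d, f s = 0}
  add_mem' := fun {f g} hf hg s hs => by simp [hf s hs, hg s hs]
  zero_mem' := fun s _ => by simp
  smul_mem' := fun c f hf s hs => by simp [hf s hs]

theorem testAbove_anti {d d' : ℝ} (h : d' ≤ d) : testAbove d ≤ testAbove d' :=
  fun _ hf s hs => hf s (hs.trans_le h)

theorem exists_mem_testAbove (f : HalfLineTest) : ∃ d > 0, f ∈ testAbove d := by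
  rcases (tsupport f).eq_empty_or_nonempty with h | h
  · exact ⟨1, one_pos, fun s _ => image_eq_zero_of_notMem_tsupport (by simp [h])⟩
  · obtain ⟨d, hd, hle⟩ := f.hasCompactSupport.isCompact.exists_isLeast h
    exact ⟨d, f.tsupport_subset hd, fun s hs =>
      image_eq_zero_of_notMem_tsupport fun hmem => absurd (hle hmem) (not_le.mpr hs)⟩

theorem exists_forall_mem_testAbove {ι : Type} [Finite ι] (f : ι → HalfLineTest) :
    ∃ d > 0, ∀ i, f i ∈ testAbove d := by
  choose d hd hf using fun i => exists_mem_testAbove (f i)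
  rcases isEmpty_or_nonempty ι with h | h
  · exact ⟨1, one_pos, fun i => isEmptyElim i⟩
  · obtain ⟨i₀, hi₀⟩ := Finite.exists_min d
    exact ⟨d i₀, hd i₀, fun i => testAbove_anti (hi₀ i) (hf i)⟩

/-! ### Factorization of the kernel. -/

/-- The variable `(s - d) / (s + d + r)`, frozen to the left of `d`. -/
noncomputable def moebius (r d s : ℝ) : ℝ := (max s d - d) / (max s d + d + r)

/-- The weight `((s + d + r) / √(2 d + r)) ^ k * exp (-α s)`, frozen to the left of `d`. -/
noncomputable def hankelWeight (α r k d s : ℝ) : ℝ :=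
  (max s d + d + r) ^ k * (2 * d + r) ^ (-k / 2) * Real.exp (-α * max s d)

section weights

variable {α r k d : ℝ}

/-- Freezing at `d` keeps the denominator at least 2d + r, so variable and weight are continuous on
the whole line. -/
theorem moebius_denom_pos (hr : 0 ≤ r) (hd : 0 < d) (s : ℝ) : 0 < max s d + d + r := by
  linarith [le_max_right s d]

theorem moebius_nonneg (hr : 0 ≤ r) (hd : 0 < d) (s : ℝ) : 0 ≤ moebius r d s :=
  div_nonneg (by linarith [le_max_right s d]) (moebius_denom_pos hr hd s).le

theorem moebius_lt_one (hr : 0 ≤ r) (hd : 0 < d) (s : ℝ) : moebius r d s < 1 := by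
  rw [moebius, div_lt_one (moebius_denom_pos hr hd s)]
  linarith

theorem continuous_moebius (hr : 0 ≤ r) (hd : 0 < d) : Continuous (moebius r d) :=
  Continuous.div (by fun_prop) (by fun_prop) fun s => (moebius_denom_pos hr hd s).ne'

theorem hankelWeight_pos (hr : 0 ≤ r) (hd : 0 < d) (s : ℝ) : 0 < hankelWeight α r k d s := by
  have := moebius_denom_pos hr hd s
  unfold hankelWeight
  positivity

theorem continuous_hankelWeight (hr : 0 ≤ r) (hd : 0 < d) : Continuous (hankelWeight α r k d) := by
  refine Continuous.mul (Continuous.mul (Continuous.rpow_const (by fun_prop) fun s => ?_)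
    continuous_const) (by fun_prop)
  exact Or.inl (moebius_denom_pos hr hd s).ne'

/-- Rests on (s + d + r)(u + d + r) - (s - d)(u - d) = (2d + r)(s + u + r). -/
theorem quasiCarleman_add_eq (hr : 0 ≤ r) (hd : 0 < d) {s u : ℝ} (hs : d ≤ s) (hu : d ≤ u) :
    quasiCarleman α r k (s + u) = hankelWeight α r k d s * hankelWeight α r k d u *
      (1 - moebius r d s * moebius r d u) ^ k := by
  have hs' : 0 < s + d + r := by linarith
  have hu' : 0 < u + d + r := by linarith
  have hc : 0 < 2 * d + r := by linarith
  have h1 : 1 - (s - d) / (s + d + r) * ((u - d) / (u + d + r))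
      = (2 * d + r) * (s + u + r) / ((s + d + r) * (u + d + r)) := by
    field_simp
    ring
  have hsu : 0 < s + u + r := by linarith
  simp only [quasiCarleman, hankelWeight, moebius, max_eq_left hs, max_eq_left hu]
  rw [h1, Real.div_rpow (by positivity) (by positivity), Real.mul_rpow hc.le hsu.le,
    Real.mul_rpow hs'.le hu'.le,
    show (2 * d + r) ^ k = ((2 * d + r) ^ (-k / 2))⁻¹ * ((2 * d + r) ^ (-k / 2))⁻¹ by
      rw [← Real.rpow_neg hc.le, ← Real.rpow_add hc]; ring_nf,
    mul_add, Real.exp_add]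
  have h2 : (2 * d + r) ^ (-k / 2) ≠ 0 := (Real.rpow_pos_of_pos hc _).ne'
  have h3 : (s + d + r) ^ k ≠ 0 := (Real.rpow_pos_of_pos hs' _).ne'
  have h4 : (u + d + r) ^ k ≠ 0 := (Real.rpow_pos_of_pos hu' _).ne'
  field_simp

theorem hasSum_quasiCarleman (hr : 0 ≤ r) (hd : 0 < d) {s u : ℝ} (hs : d ≤ s) (hu : d ≤ u) :
    HasSum (fun j => signedBinomial k j *
      ((moebius r d s ^ j * hankelWeight α r k d s) * (moebius r d u ^ j * hankelWeight α r k d u)))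
      (quasiCarleman α r k (s + u)) := by
  have hz : |moebius r d s * moebius r d u| < 1 := by
    rw [abs_of_nonneg (mul_nonneg (moebius_nonneg hr hd s) (moebius_nonneg hr hd u))]
    exact mul_lt_one_of_nonneg_of_lt_one_left (moebius_nonneg hr hd s) (moebius_lt_one hr hd s)
      (moebius_lt_one hr hd u).le
  rw [quasiCarleman_add_eq hr hd hs hu]
  refine ((hasSum_signedBinomial k hz).mul_left _).congr_fun fun j => ?_
  rw [mul_pow]
  ring

end weights

/-! ### Expansion of the form in moments. -/

section moments

variable {α r k d : ℝ}

/-- The kernel of the `j`-th moment functional. -/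
noncomputable def momentKernel (α r k d : ℝ) (j : ℕ) (s : ℝ) : ℂ :=
  ((moebius r d s ^ j * hankelWeight α r k d s : ℝ) : ℂ)

theorem continuous_momentKernel (hr : 0 ≤ r) (hd : 0 < d) (j : ℕ) :
    Continuous (momentKernel α r k d j) :=
  Complex.continuous_ofReal.comp
    (((continuous_moebius hr hd).pow j).mul (continuous_hankelWeight hr hd))

/-- The `j`-th moment of a test function in the variable `moebius`. -/
noncomputable def hankelMoment (α k : ℝ) (hr : 0 ≤ r) (hd : 0 < d) (j : ℕ) :
    HalfLineTest →ₗ[ℂ] ℂ where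
  toFun f := ∫ s, momentKernel α r k d j s * f s
  map_add' f g := by
    rw [← integral_add (f.integrable_mul (continuous_momentKernel hr hd j))
      (g.integrable_mul (continuous_momentKernel hr hd j))]
    simp [mul_add]
  map_smul' c f := by
    rw [RingHom.id_apply, smul_eq_mul, ← integral_const_mul]
    simp [mul_left_comm]

/-- On the compact support the variable stays below some q < 1. This geometric decay justifies
exchanging sums and integrals. -/
theorem exists_integral_norm_momentKernel_le (hr : 0 ≤ r) (hd : 0 < d) (f : HalfLineTest) :
    ∃ q C : ℝ, 0 ≤ q ∧ q < 1 ∧ 0 ≤ C ∧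
      ∀ j, ∫ s, ‖momentKernel α r k d j s * f s‖ ≤ q ^ j * C := by
  -- Inserting 0 keeps the compact set nonempty when `f = 0`.
  obtain ⟨s₀, -, hmax⟩ := (f.hasCompactSupport.isCompact.insert 0).exists_isMaxOn
    (Set.insert_nonempty _ _) (continuous_moebius hr hd).continuousOn
  refine ⟨moebius r d s₀, ∫ s, ‖momentKernel α r k d 0 s * f s‖, moebius_nonneg hr hd _,
    moebius_lt_one hr hd _, integral_nonneg fun _ => norm_nonneg _, fun j => ?_⟩
  rw [← integral_const_mul]
  refine integral_mono (f.integrable_mul (continuous_momentKernel hr hd j)).norm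
    ((f.integrable_mul (continuous_momentKernel hr hd 0)).norm.const_mul _) fun s => ?_
  by_cases hs : s ∈ tsupport f
  · have hle : moebius r d s ≤ moebius r d s₀ := hmax (Set.mem_insert_of_mem _ hs)
    have : ‖momentKernel α r k d j s‖ ≤ moebius r d s₀ ^ j * ‖momentKernel α r k d 0 s‖ := by
      simp only [momentKernel, Complex.norm_real, norm_mul, pow_zero, one_mul, norm_pow,
        Real.norm_of_nonneg (moebius_nonneg hr hd s)]
      gcongr
      exact moebius_nonneg hr hd s
    simp only [norm_mul]
    rw [← mul_assoc]
    gcongr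
  · simp [image_eq_zero_of_notMem_tsupport hs]

/-- The expansion of the Hankel form in squares of moments. -/
theorem hasSum_hankelForm (hr : 0 ≤ r) (hd : 0 < d) {f : HalfLineTest} (hf : f ∈ testAbove d) :
    HasSum (fun j => ((signedBinomial k j * ‖hankelMoment α k hr hd j f‖ ^ 2 : ℝ) : ℂ))
      (hankelForm (quasiCarleman α r k) f) := by
  have hint : Integrable
      (fun p : ℝ × ℝ => (quasiCarleman α r k (p.1 + p.2) : ℂ) * (f p.1 * conj (f p.2))) := by
    -- The kernel may be singular at the origin when `r = 0`; the frozen arguments give a continuous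
    -- integrand with the same values.
    have heq : (fun p : ℝ × ℝ => (quasiCarleman α r k (p.1 + p.2) : ℂ) * (f p.1 * conj (f p.2)))
        = fun p => (quasiCarleman α r k (max p.1 d + max p.2 d) : ℂ) * (f p.1 * conj (f p.2)) := by
      funext p
      rcases lt_or_ge p.1 d with h1 | h1
      · simp [hf _ h1]
      rcases lt_or_ge p.2 d with h2 | h2
      · simp [hf _ h2]
      rw [max_eq_left h1, max_eq_left h2]
    rw [heq]
    refine Continuous.integrable_of_hasCompactSupport ?_ ?_
    · refine (Complex.continuous_ofReal.comp ?_).mul (by fun_prop)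
      refine Continuous.mul (Continuous.rpow_const (by fun_prop) fun p => Or.inl ?_) (by fun_prop)
      have := le_max_right p.1 d
      have := le_max_right p.2 d
      linarith
    · refine HasCompactSupport.intro
        (f.hasCompactSupport.isCompact.prod f.hasCompactSupport.isCompact) fun p hp => ?_
      rw [Set.mem_prod, not_and_or] at hp
      rcases hp with hp | hp <;> simp [image_eq_zero_of_notMem_tsupport hp]
  set φ : ℕ → ℝ → ℂ := fun j s => momentKernel α r k d j s * f s with hφ
  have hφi : ∀ j, Integrable (φ j) := fun j =>
    f.integrable_mul (continuous_momentKernel hr hd j)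
  have hφc : ∀ j, Integrable (fun s => conj (φ j s)) := fun j =>
    (Complex.conjLIE.toContinuousLinearEquiv.toContinuousLinearMap.integrable_comp (hφi j))
  set F : ℕ → ℝ × ℝ → ℂ := fun j p => (signedBinomial k j : ℂ) * (φ j p.1 * conj (φ j p.2)) with hF
  have hFi : ∀ j, Integrable (F j) := fun j => ((hφi j).mul_prod (hφc j)).const_mul _
  have hnorm : ∀ j, ∫ p, ‖F j p‖ = |signedBinomial k j| * (∫ s, ‖φ j s‖) ^ 2 := fun j => by
    have : ∀ p, ‖F j p‖ = |signedBinomial k j| * (‖φ j p.1‖ * ‖φ j p.2‖) := fun p => by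
      simp [hF]
    simp_rw [this]
    rw [integral_const_mul, Measure.volume_eq_prod,
      integral_prod_mul (fun s => ‖φ j s‖) (fun s => ‖φ j s‖), sq]
  obtain ⟨q, C, hq0, hq1, hC, hqC⟩ :=
    exists_integral_norm_momentKernel_le (α := α) (k := k) hr hd f
  have hsum : Summable fun j => ∫ p, ‖F j p‖ := by
    simp_rw [hnorm]
    have hq2 : q ^ 2 < 1 := by nlinarith
    refine ((summable_abs_signedBinomial k (sq_nonneg q) hq2).mul_right (C ^ 2)).of_nonneg_of_le
      (fun j => by positivity) fun j => ?_
    have h0 : 0 ≤ ∫ s, ‖φ j s‖ := integral_nonneg fun _ => norm_nonneg _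
    calc |signedBinomial k j| * (∫ s, ‖φ j s‖) ^ 2
        ≤ |signedBinomial k j| * (q ^ j * C) ^ 2 := by gcongr; exact hqC j
      _ = _ := by ring
  have hmain := hasSum_integral_of_summable_integral_norm hFi hsum
  rw [hankelForm_eq_integral_prod _ _ hint]
  have htsum : (fun p => ∑' j, F j p)
      = fun p : ℝ × ℝ => (quasiCarleman α r k (p.1 + p.2) : ℂ) * (f p.1 * conj (f p.2)) := by
    funext p
    rcases lt_or_ge p.1 d with h1 | h1
    · simp [hF, hφ, hf _ h1]
    rcases lt_or_ge p.2 d with h2 | h2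
    · simp [hF, hφ, hf _ h2]
    have h3 := (Complex.hasSum_ofReal.mpr
      (hasSum_quasiCarleman (α := α) (k := k) hr hd h1 h2)).mul_right (f p.1 * conj (f p.2))
    refine HasSum.tsum_eq (h3.congr_fun fun j => ?_)
    simp only [hF, hφ, momentKernel, map_mul, Complex.conj_ofReal]
    push_cast
    ring
  rw [htsum] at hmain
  refine hmain.congr_fun fun j => ?_
  simp only [hF]
  rw [integral_const_mul, Measure.volume_eq_prod,
    integral_prod_mul (φ j) (fun s => conj (φ j s)), integral_conj, Complex.mul_conj']
  push_cast
  rfl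

theorem hankelForm_im_eq_zero (α k : ℝ) (hr : 0 ≤ r) (f : HalfLineTest) :
    (hankelForm (quasiCarleman α r k) f).im = 0 := by
  obtain ⟨d, hd, hf⟩ := exists_mem_testAbove f
  have h := Complex.hasSum_im (hasSum_hankelForm (α := α) (k := k) hr hd hf)
  simp only [Complex.ofReal_im] at h
  exact h.unique hasSum_zero

theorem hasSum_hankelQuad (hr : 0 ≤ r) (hd : 0 < d) {f : HalfLineTest} (hf : f ∈ testAbove d) :
    HasSum (fun j => signedBinomial k j * ‖hankelMoment α k hr hd j f‖ ^ 2)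
      (hankelQuad (quasiCarleman α r k) f) := by
  have h := Complex.hasSum_re (hasSum_hankelForm (α := α) (k := k) hr hd hf)
  simp only [Complex.ofReal_re] at h
  exact h

theorem hankelQuad_nonneg_of_neg (α : ℝ) (hr : 0 ≤ r) (hk : k < 0) (f : HalfLineTest) :
    0 ≤ hankelQuad (quasiCarleman α r k) f := by
  obtain ⟨d, hd, hf⟩ := exists_mem_testAbove f
  exact (hasSum_hankelQuad (α := α) hr hd hf).nonneg fun j =>
    mul_nonneg (signedBinomial_pos_of_neg hk j).le (sq_nonneg _)

/-- The moments of a test function, scaled by the square roots of the binomial coefficients. -/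
noncomputable def scaledMoments (α k : ℝ) (hr : 0 ≤ r) (hd : 0 < d) :
    testAbove d →ₗ[ℂ] lp (fun _ : ℕ => ℂ) 2 where
  toFun f := ⟨fun j => (√|signedBinomial k j| : ℂ) * hankelMoment α k hr hd j f, by
    refine memℓp_gen ?_
    have h := (hasSum_hankelQuad (α := α) (k := k) hr hd f.2).summable.abs
    refine h.congr fun j => ?_
    simp [abs_mul, mul_pow, Real.sq_sqrt]⟩
  map_add' f g := by
    ext j
    simp only [Submodule.coe_add, map_add, mul_add, lp.coeFn_add, Pi.add_apply]
  map_smul' c f := by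
    ext j
    simp [mul_left_comm]

theorem norm_scaledMoments_apply_sq (hr : 0 ≤ r) (hd : 0 < d) (f : testAbove d) (j : ℕ) :
    ‖scaledMoments α k hr hd f j‖ ^ 2
      = |signedBinomial k j| * ‖hankelMoment α k hr hd j f‖ ^ 2 := by
  simp [scaledMoments, mul_pow, Real.sq_sqrt]

end moments

/-! ### Density of the scaled moments in ℓ². -/

/-- A power series with coefficients `b` converging on the unit disc is continuous there. -/
theorem continuousOn_tsum_mul_pow {b : ℕ → ℂ}
    (hb : ∀ q : ℝ, 0 ≤ q → q < 1 → Summable fun j => ‖b j‖ * q ^ j) :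
    ContinuousOn (fun z : ℂ => ∑' j, b j * z ^ j) (Metric.ball 0 1) := by
  intro z hz
  obtain ⟨q, hzq, hq⟩ := exists_between (mem_ball_zero_iff.mp hz)
  have hq0 : 0 ≤ q := (norm_nonneg z).trans hzq.le
  have h : ContinuousOn (fun z : ℂ => ∑' j, b j * z ^ j) (Metric.ball 0 q) := by
    refine continuousOn_tsum (fun j => by fun_prop) (hb q hq0 hq) fun j w hw => ?_
    rw [norm_mul, norm_pow]
    gcongr
    exact (mem_ball_zero_iff.mp hw).le
  exact (h.continuousAt (Metric.isOpen_ball.mem_nhds (mem_ball_zero_iff.mpr hzq))).continuousWithinAt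

section density

variable {α r k d : ℝ}

theorem exists_moebius_eq (hr : 0 ≤ r) (hd : 0 < d) {w : ℝ} (hw0 : 0 < w) (hw1 : w < 1) :
    ∃ s, d < s ∧ moebius r d s = w := by
  have h1 : 0 < 1 - w := by linarith
  have hs : d < (d + (d + r) * w) / (1 - w) := by
    rw [lt_div_iff₀ h1]
    nlinarith [mul_pos hd hw0, mul_nonneg hr hw0.le]
  refine ⟨_, hs, ?_⟩
  rw [moebius, max_eq_left hs.le, div_eq_iff (by linarith)]
  field_simp
  ring

/-- A real smooth function with compact support as an element of `testAbove`. -/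
theorem exists_testAbove_eq (hd : 0 < d) {g : ℝ → ℝ} (hg : ContDiff ℝ ((⊤ : ℕ∞) : WithTop ℕ∞) g)
    (hc : HasCompactSupport g) (hs : tsupport g ⊆ Set.Ioi d) :
    ∃ f : testAbove d, ∀ s, (f : HalfLineTest) s = (g s : ℂ) := by
  have hsub : tsupport (fun s => (g s : ℂ)) ⊆ tsupport g :=
    closure_mono fun s hs => by simpa using hs
  have hsmooth : ContDiff ℝ ((⊤ : ℕ∞) : WithTop ℕ∞) (fun s => (g s : ℂ)) :=
    Complex.ofRealCLM.contDiff.comp hg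
  have hcpt : HasCompactSupport (fun s => (g s : ℂ)) := hc.mono' (by
    intro s hs
    exact subset_tsupport g (by simpa using hs))
  let F : HalfLineTest := TestFunction.mk _ hsmooth hcpt fun s h => hd.trans (hs (hsub h))
  have hF : ∀ s, F s = (g s : ℂ) := fun s => rfl
  refine ⟨⟨F, fun s hsd => ?_⟩, hF⟩
  rw [hF, image_eq_zero_of_notMem_tsupport fun h => absurd (hs h) (not_lt.mpr hsd.le),
    Complex.ofReal_zero]

/-- A power series in `moebius` that annihilates all test functions vanishes. -/
theorem eq_zero_of_tsum_mul_hankelMoment_eq_zero (hr : 0 ≤ r) (hd : 0 < d) {b : ℕ → ℂ}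
    (hb : ∀ q : ℝ, 0 ≤ q → q < 1 → Summable fun j => ‖b j‖ * q ^ j)
    (h0 : ∀ f : testAbove d, ∑' j, b j * hankelMoment α k hr hd j f = 0) : b = 0 := by
  set G : ℝ → ℂ := fun s =>
    (∑' j, b j * (moebius r d s : ℂ) ^ j) * (hankelWeight α r k d s : ℂ) with hG
  have hGcont : Continuous G := by
    refine Continuous.mul ?_ (Complex.continuous_ofReal.comp (continuous_hankelWeight hr hd))
    refine (continuousOn_tsum_mul_pow hb).comp_continuous
      (Complex.continuous_ofReal.comp (continuous_moebius hr hd)) fun s => ?_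
    rw [mem_ball_zero_iff, Complex.norm_real,
      Real.norm_of_nonneg (moebius_nonneg hr hd s)]
    exact moebius_lt_one hr hd s
  -- A locally integrable function whose integrals against all smooth compactly supported functions
  -- vanish is zero almost everywhere.
  have hae : ∀ᵐ s, s ∈ Set.Ioi d → G s = 0 := by
    refine isOpen_Ioi.ae_eq_zero_of_integral_contDiff_smul_eq_zero
      (hGcont.locallyIntegrable.locallyIntegrableOn _) fun g hg hc hs => ?_
    obtain ⟨f, hf⟩ := exists_testAbove_eq hd hg hc hs
    obtain ⟨q, C, hq0, hq1, hC, hqC⟩ :=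
      exists_integral_norm_momentKernel_le (α := α) (k := k) hr hd (f : HalfLineTest)
    have hsum := hasSum_integral_of_summable_integral_norm
      (F := fun j s => b j * (momentKernel α r k d j s * (f : HalfLineTest) s)) (μ := volume)
      (fun j => ((f : HalfLineTest).integrable_mul (continuous_momentKernel hr hd j)).const_mul _)
      (by
        refine ((hb q hq0 hq1).mul_right C).of_nonneg_of_le
          (fun j => integral_nonneg fun _ => norm_nonneg _) fun j => ?_
        simp_rw [norm_mul (b j)]
        rw [integral_const_mul, mul_assoc]
        exact mul_le_mul_of_nonneg_left (hqC j) (norm_nonneg _))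
    have h1 : ∀ j, ∫ s, b j * (momentKernel α r k d j s * (f : HalfLineTest) s)
        = b j * hankelMoment α k hr hd j f := fun j => integral_const_mul _ _
    simp_rw [h1] at hsum
    rw [← (hsum.tsum_eq.symm.trans (h0 f))]
    refine integral_congr_ae (Filter.Eventually.of_forall fun s => ?_)
    simp only [hG, hf, momentKernel]
    rw [Complex.real_smul, mul_comm, ← tsum_mul_right, ← tsum_mul_right]
    refine tsum_congr fun j => ?_
    push_cast
    ring
  have hzero : Set.EqOn G (fun _ => 0) (Set.Ioi d) :=
    Measure.eqOn_open_of_ae_eq ((ae_restrict_iff' measurableSet_Ioi).mpr hae) isOpen_Ioi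
      hGcont.continuousOn continuousOn_const
  -- The Möbius variable takes every value in (0, 1) on (d, ∞), and the weight never vanishes.
  refine eq_zero_of_tsum_mul_pow_eq_zero hb fun w hw0 hw1 => ?_
  obtain ⟨s, hs, rfl⟩ := exists_moebius_eq hr hd hw0 hw1
  exact (mul_eq_zero.mp (hzero hs)).resolve_right
    (Complex.ofReal_ne_zero.mpr (hankelWeight_pos hr hd s).ne')

/-- A vector y orthogonal to the range yields a power series with coefficients conj(y_j) √|c_j|
annihilating all test functions. It vanishes, and c_j ≠ 0 forces y = 0. -/
theorem dense_range_scaledMoments (α : ℝ) (hr : 0 ≤ r) (hd : 0 < d) (hk : ∀ n : ℕ, k ≠ n) :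
    Dense (LinearMap.range (scaledMoments α k hr hd) : Set (lp (fun _ : ℕ => ℂ) 2)) := by
  rw [Submodule.dense_iff_topologicalClosure_eq_top, Submodule.topologicalClosure_eq_top_iff,
    Submodule.eq_bot_iff]
  intro y hy
  rw [Submodule.mem_orthogonal'] at hy
  have hb0 : (fun j => conj (y j) * (√|signedBinomial k j| : ℂ)) = 0 := by
    refine eq_zero_of_tsum_mul_hankelMoment_eq_zero (α := α) (k := k) hr hd ?_ fun f => ?_
    · intro q hq0 hq1
      refine (((summable_geometric_of_lt_one hq0 hq1).add
        (summable_abs_signedBinomial k hq0 hq1)).mul_left ‖y‖).of_nonneg_of_le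
        (fun j => by positivity) fun j => ?_
      have h1 : ‖y j‖ ≤ ‖y‖ := lp.norm_apply_le_norm (by norm_num) y j
      have h2 : √|signedBinomial k j| ≤ 1 + |signedBinomial k j| := by
        rw [Real.sqrt_le_left (by positivity)]
        nlinarith [abs_nonneg (signedBinomial k j)]
      simp only [norm_mul, RCLike.norm_conj, Complex.norm_real,
        Real.norm_of_nonneg (Real.sqrt_nonneg _)]
      calc ‖y j‖ * √|signedBinomial k j| * q ^ j
          ≤ ‖y‖ * (1 + |signedBinomial k j|) * q ^ j := by gcongr
        _ = _ := by ring
    · have h := hy _ ⟨f, rfl⟩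
      rw [lp.inner_eq_tsum] at h
      rw [← h]
      refine tsum_congr fun j => ?_
      rw [RCLike.inner_apply]
      simp only [scaledMoments, LinearMap.coe_mk, AddHom.coe_mk]
      ring
  ext j
  have h := congrFun hb0 j
  have hne : (√|signedBinomial k j| : ℂ) ≠ 0 :=
    Complex.ofReal_ne_zero.mpr
      (Real.sqrt_pos.mpr (abs_pos.mpr (signedBinomial_ne_zero hk j))).ne'
  simpa [hne] using h

theorem orthonormal_lp_single :
    Orthonormal ℂ fun i : ℕ => (lp.single 2 i (1 : ℂ) : lp (fun _ : ℕ => ℂ) 2) := by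
  rw [orthonormal_iff_ite]
  intro i j
  rw [lp.inner_single_left, lp.single_apply]
  rcases eq_or_ne i j with rfl | h
  · simp
  · simp [h]

theorem not_finiteDimensional_lp : ¬ FiniteDimensional ℂ (lp (fun _ : ℕ => ℂ) 2) := by
  intro h
  have := orthonormal_lp_single.linearIndependent.finite
  exact not_finite ℕ

/-- For non-integer `k > 0` the Hankel form has the signature determined by the indices of the
same parity as `⌊k⌋₊`. -/
theorem hankelQuad_eq_scaledMoments (hr : 0 ≤ r) (hd : 0 < d) (hk : 0 < k) (f : testAbove d) :
    (-1) ^ ⌊k⌋₊ * hankelQuad (quasiCarleman α r k) f =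
      2 * (∑ j ∈ sameParityIndices ⌊k⌋₊, ‖scaledMoments α k hr hd f j‖ ^ 2)
        - ‖scaledMoments α k hr hd f‖ ^ 2 := by
  set J := sameParityIndices ⌊k⌋₊
  set y := scaledMoments α k hr hd f with hy
  have h1 := (hasSum_hankelQuad (α := α) (k := k) hr hd f.2).mul_left ((-1) ^ ⌊k⌋₊)
  have h2 : HasSum (fun j => ‖y j‖ ^ 2) (‖y‖ ^ 2) := by
    simpa using lp.hasSum_norm (p := 2) (by norm_num) y
  have h3 : HasSum (fun j => if j ∈ J then ‖y j‖ ^ 2 else 0) (∑ j ∈ J, ‖y j‖ ^ 2) := by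
    have : HasSum (fun j => if j ∈ J then ‖y j‖ ^ 2 else 0)
        (∑ j ∈ J, if j ∈ J then ‖y j‖ ^ 2 else 0) :=
      hasSum_sum_of_ne_finset_zero fun j hj => if_neg hj
    rwa [Finset.sum_congr rfl fun j hj => if_pos hj] at this
  -- The sign of the j-th term is 2 · 1_J(j) - 1, whence twice the partial sum minus the full norm.
  refine h1.unique (((h3.mul_left 2).sub h2).congr_fun fun j => ?_)
  rw [hy, norm_scaledMoments_apply_sq, ← mul_assoc, sign_signedBinomial hk]
  split_ifs <;> ring

end density

/-! ### Computation of the indices. -/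

section index

variable {α r k : ℝ}

theorem card_le_of_pos_on_submodule (hr : 0 ≤ r) (hk : 0 < k) (M : Submodule ℂ HalfLineTest)
    (hM : ∀ φ ∈ M, φ ≠ 0 → 0 < (-1) ^ ⌊k⌋₊ * hankelQuad (quasiCarleman α r k) φ) :
    Cardinal.toENat (Module.rank ℂ M) ≤ (⌊k⌋₊ / 2 + 1 : ℕ) := by
  by_contra! hlt
  have hle : ((⌊k⌋₊ / 2 + 1 + 1 : ℕ) : ℕ∞) ≤ Cardinal.toENat (Module.rank ℂ M) := by
    have := Order.add_one_le_of_lt hlt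
    exact_mod_cast this
  obtain ⟨s, hcard, hli⟩ :=
    le_rank_iff_exists_linearIndependent_finset.mp (Cardinal.natCast_le_toENat.mp hle)
  -- Only finitely many vectors are retained so that a single `d`, and hence one moment expansion,
  -- serves them all.
  obtain ⟨d, hd, hs⟩ := exists_forall_mem_testAbove fun i : s => ((i : M) : HalfLineTest)
  let Φ : (s → ℂ) →ₗ[ℂ] M := Fintype.linearCombination ℂ (fun i : s => (i : M))
  let A : (s → ℂ) →ₗ[ℂ] (sameParityIndices ⌊k⌋₊ → ℂ) :=
    LinearMap.pi fun j => hankelMoment α k hr hd j ∘ₗ M.subtype ∘ₗ Φ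
  -- There is one more coefficient than there are moments to annihilate; on such a combination only
  -- nonpositive terms remain.
  have hker : LinearMap.ker A ≠ ⊥ := LinearMap.ker_ne_bot_of_finrank_lt (by
    rw [Module.finrank_fintype_fun_eq_card, Module.finrank_fintype_fun_eq_card, Fintype.card_coe,
      Fintype.card_coe, card_sameParityIndices, hcard]
    omega)
  obtain ⟨z, hz, hz0⟩ := Submodule.exists_mem_ne_zero_of_ne_bot hker
  set f : HalfLineTest := ((Φ z : M) : HalfLineTest) with hf
  have hf0 : f ≠ 0 := fun h0 => hz0 (by
    have h1 : Φ z = 0 := Subtype.ext h0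
    funext i
    exact Fintype.linearIndependent_iff.mp hli z h1 i)
  have hfd : f ∈ testAbove d := by
    rw [hf, Fintype.linearCombination_apply, Submodule.coe_sum]
    exact Submodule.sum_mem _ fun i _ => Submodule.smul_mem _ _ (hs i)
  have hpos := hM f (Φ z).2 hf0
  have hAz : ∀ j ∈ sameParityIndices ⌊k⌋₊, hankelMoment α k hr hd j f = 0 := fun j hj =>
    congrFun (LinearMap.mem_ker.mp hz) ⟨j, hj⟩
  have heq := hankelQuad_eq_scaledMoments (α := α) hr hd hk ⟨f, hfd⟩
  rw [Finset.sum_eq_zero fun j hj => by rw [norm_scaledMoments_apply_sq, hAz j hj]; simp] at heq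
  simp only at heq
  nlinarith [sq_nonneg ‖scaledMoments α k hr hd ⟨f, hfd⟩‖]

/-- A subspace of the range of `scaledMoments` lifts to test functions. -/
theorem exists_submodule_test {d : ℝ} (hr : 0 ≤ r) (hd : 0 < d)
    {W : Submodule ℂ (lp (fun _ : ℕ => ℂ) 2)}
    (hW : W ≤ LinearMap.range (scaledMoments α k hr hd)) :
    ∃ M : Submodule ℂ HalfLineTest, Module.rank ℂ M = Module.rank ℂ W ∧
      ∀ φ ∈ M, φ ≠ 0 → ∃ f : testAbove d, (f : HalfLineTest) = φ ∧
        scaledMoments α k hr hd f ∈ W ∧ scaledMoments α k hr hd f ≠ 0 := by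
  obtain ⟨M, hrank, hM⟩ := (scaledMoments α k hr hd).exists_submodule_lift hW
  refine ⟨M.map (testAbove d).subtype, ?_, ?_⟩
  · rw [← hrank]
    exact (Submodule.equivMapOfInjective _ (Submodule.injective_subtype _) M).rank_eq.symm
  · rintro _ ⟨f, hf, rfl⟩ h0
    exact ⟨f, rfl, (hM f hf).1, (hM f hf).2 fun h => h0 (by simp [h])⟩

theorem isPosIndex_finite (α : ℝ) (hr : 0 ≤ r) (hk : 0 < k) (hn : ∀ n : ℕ, k ≠ n) :
    IsPosIndex (fun φ => (-1) ^ ⌊k⌋₊ * hankelQuad (quasiCarleman α r k) φ)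
      ((⌊k⌋₊ / 2 + 1 : ℕ) : ℕ∞) := by
  refine ⟨?_, ?_⟩
  -- Any `d > 0` would do, as density holds for each; `d = 1` is taken.
  · obtain ⟨W, hW, hrank, hpos⟩ :=
      (dense_range_scaledMoments α hr one_pos hn).exists_submodule_norm_sq_lt
      (orthonormal_lp_single.comp (fun j : sameParityIndices ⌊k⌋₊ => (j : ℕ))
        Subtype.val_injective)
    obtain ⟨M, hMrank, hM⟩ := exists_submodule_test hr one_pos hW
    refine ⟨M, fun φ hφ h0 => ?_, ?_⟩
    · beta_reduce
      obtain ⟨f, rfl, hfW, hf0⟩ := hM φ hφ h0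
      have h := hpos _ hfW hf0
      rw [hankelQuad_eq_scaledMoments hr one_pos hk]
      simp only [Function.comp_apply, lp.inner_single_left, RCLike.inner_apply, map_one,
        mul_one] at h
      rw [Finset.sum_coe_sort (sameParityIndices ⌊k⌋₊)
        (fun j => ‖scaledMoments α k hr one_pos f j‖ ^ 2)] at h
      linarith
    · rw [hMrank, hrank, Fintype.card_coe, card_sameParityIndices]
      simp
  · rintro _ ⟨M, hM, rfl⟩
    exact card_le_of_pos_on_submodule hr hk M hM

theorem isPosIndex_infinite (α : ℝ) (hr : 0 ≤ r) (hk : 0 < k) (hn : ∀ n : ℕ, k ≠ n) :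
    IsPosIndex (fun φ => -((-1) ^ ⌊k⌋₊ * hankelQuad (quasiCarleman α r k) φ)) ⊤ := by
  refine ⟨?_, fun _ _ => le_top⟩
  obtain ⟨W, hW, hrank, horth⟩ :=
    (dense_range_scaledMoments α hr one_pos hn).exists_submodule_orthogonal
      not_finiteDimensional_lp
      (fun j : sameParityIndices ⌊k⌋₊ => (lp.single 2 (j : ℕ) (1 : ℂ) : lp (fun _ : ℕ => ℂ) 2))
  obtain ⟨M, hMrank, hM⟩ := exists_submodule_test hr one_pos hW
  refine ⟨M, fun φ hφ h0 => ?_, ?_⟩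
  · beta_reduce
    obtain ⟨f, rfl, hfW, hf0⟩ := hM φ hφ h0
    have h := horth _ hfW
    simp only [lp.inner_single_left, RCLike.inner_apply, map_one, mul_one] at h
    -- With the components in J gone, the negated form equals the squared ℓ² norm.
    rw [hankelQuad_eq_scaledMoments hr one_pos hk,
      Finset.sum_eq_zero fun j hj => by rw [h ⟨j, hj⟩]; simp]
    have := norm_pos_iff.mpr hf0
    nlinarith
  · rw [hMrank]
    exact Cardinal.toENat_eq_top.mpr hrank

end index

theorem theorem6p4 (α r k : ℝ) (hr : 0 ≤ r) :
    (∀ f : HalfLineTest, (hankelForm (quasiCarleman α r k) f).im = 0) ∧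
    (k < 0 → ∀ f : HalfLineTest, 0 ≤ hankelQuad (quasiCarleman α r k) f) ∧
    (0 < k → (∀ n : ℕ, k ≠ (n : ℝ)) →
      (Even ⌊k⌋₊ →
        IsPosIndex (hankelQuad (quasiCarleman α r k)) ((⌊k⌋₊ / 2 + 1 : ℕ) : ℕ∞) ∧
        IsNegIndex (hankelQuad (quasiCarleman α r k)) ⊤) ∧
      (Odd ⌊k⌋₊ →
        IsNegIndex (hankelQuad (quasiCarleman α r k)) (((⌊k⌋₊ + 1) / 2 : ℕ) : ℕ∞) ∧
        IsPosIndex (hankelQuad (quasiCarleman α r k)) ⊤)) := by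
  refine ⟨hankelForm_im_eq_zero α k hr, fun hk => hankelQuad_nonneg_of_neg α hr hk,
    fun hk hn => ?_⟩
  have hfin := isPosIndex_finite α hr hk hn
  have hinf := isPosIndex_infinite α hr hk hn
  refine ⟨fun he => ?_, fun ho => ?_⟩
  · simp only [he.neg_one_pow, one_mul] at hfin hinf
    exact ⟨hfin, hinf⟩
  · simp only [ho.neg_one_pow, neg_mul, one_mul, neg_neg] at hfin hinf
    -- For odd ⌊k⌋ the natural-number quotient ⌊k⌋/2 rounds down, so both counts agree.
    rw [show (⌊k⌋₊ + 1) / 2 = ⌊k⌋₊ / 2 + 1 by obtain ⟨m, hm⟩ := ho; omega]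
    exact ⟨hfin, hinf⟩
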